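/- Let $d\ge 1$ and $N$ be positive integers, let $m_1,\dots,m_N>0$, and let $F:\mathbb R^N\times\mathbb R^N\times\mathbb R^{N\times d}\to\mathbb R^N$ satisfy, for some constant $C_0$, $$|F(\zeta,\eta,\Theta)|\le C_0\left(|\zeta|^2+|\eta|^2+|\Theta|_{Fr}^2\right)^{\frac12\left(1+\frac2d\right)}\qquad\text{for all }(\zeta,\eta,\Theta),$$ where $|\cdot|$ is the Euclidean norm and $|\cdot|_{Fr}$ is the Frobenius norm. Consider the Klein–Gordon system $$(\partial_t^2-\Delta+m_j^2)u_j=F_j(u,\partial_tu,Du),\qquad x\in\mathbb R^d,\quad j=1,\dots,N,$$ for $u=(u_1,\dots,u_N)$, where $Du=(\partial_{x_k}u_j)_{j,k}$. A classical solution on a nondegenerate time interval $I\subset\mathbb R$ is a function $u:I\times\mathbb R^d\to\mathbb R^N$ of class $C^2$ (with one-sided time derivatives at end points belonging to $I$) that satisfies the system at every point of $I\times\mathbb R^d$. Assume that classical solutions of the initial value problem are unique: if $u_1,u_2$ are classical solutions on the same time interval $I$, and $u_1(t_0,\cdot)=u_2(t_0,\cdot)$ and $\partial_tu_1(t_0,\cdot)=\partial_tu_2(t_0,\cdot)$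 for some $t_0\in I$, then $u_1=u_2$ on $I\times\mathbb R^d$. Let $T\in\mathbb R$ and let $u$ be a classical solution on $[T,\infty)$. Assume that there are constants $C>0$ and $T_1>1$ with $T_1\ge T$ such that $$\|u(t,\cdot)\|_{L^\infty}+\big\||Du(t,\cdot)|_{Fr}\big\|_{L^\infty}\le C\,t^{-\frac d2}(\log t)^{-\frac d2}\qquad\text{for all }t\ge T_1,$$ and that for every $\varepsilon>0$ there is $T_2\ge T_1$ such that $$\|\partial_tu(t,\cdot)\|_{L^\infty}\le\varepsilon\,t^{-\frac d2}(\log t)^{-\frac d2}\qquad\text{for all }t\ge T_2.$$ Then $u(t,x)=0$ for all $t\ge T$ and all $x\in\mathbb R^d$. -/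

import Mathlib

noncomputable section

namespace KleinGordon

open MeasureTheory

/-- `ℝ^n` with its Euclidean norm. -/
abbrev Vec (n : ℕ) : Type := EuclideanSpace ℝ (Fin n)

/-- The Frobenius norm of a real `N × d` matrix. -/
def frob {N d : ℕ} (Θ : Matrix (Fin N) (Fin d) ℝ) : ℝ :=
  Real.sqrt (∑ j, ∑ k, Θ j k ^ 2)

/-- The first time derivative `∂ₜ u (t, x)` of a function on `I × ℝ^d`; it is one-sided at an
end point of the time interval `I` that belongs to `I`. -/
def timeDeriv {N d : ℕ} (I : Set ℝ) (u : ℝ → Vec d → Vec N) (t : ℝ) (x : Vec d) : Vec N :=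
  derivWithin (fun s => u s x) I t

/-- The spatial Jacobian `D u (t, x)`, the matrix whose entry `(j, k)` is `∂ₖ uⱼ (t, x)`. -/
def spaceDeriv {N d : ℕ} (u : ℝ → Vec d → Vec N) (t : ℝ) (x : Vec d) :
    Matrix (Fin N) (Fin d) ℝ :=
  Matrix.of fun j k => fderiv ℝ (fun y => u t y j) x (EuclideanSpace.single k 1)

/-- The nonlinearity is of critical order:
`|F(ζ, η, Θ)| ≤ C (|ζ|² + |η|² + |Θ|²) ^ ((1 + 2 / d) / 2)` for some constant `C`. -/
def CriticalGrowth {N d : ℕ} (F : Vec N → Vec N → Matrix (Fin N) (Fin d) ℝ → Vec N) : Prop :=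
  ∃ C : ℝ, ∀ (ζ η : Vec N) (Θ : Matrix (Fin N) (Fin d) ℝ),
    ‖F ζ η Θ‖ ≤ C * (‖ζ‖ ^ 2 + ‖η‖ ^ 2 + frob Θ ^ 2) ^ ((1 / 2 : ℝ) * (1 + 2 / (d : ℝ)))

/-- `u` is a classical solution on the time interval `I` of the Klein–Gordon system
`(∂ₜ² - Δ + mⱼ²) uⱼ = Fⱼ(u, ∂ₜ u, D u)`, `1 ≤ j ≤ N`: it is of class `C²` on `I × ℝ^d` and
satisfies the equations at every point of `I × ℝ^d`. The values of `u` at times outside `I`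
play no role. -/
structure IsClassicalSolution {N d : ℕ} (m : Fin N → ℝ)
    (F : Vec N → Vec N → Matrix (Fin N) (Fin d) ℝ → Vec N)
    (I : Set ℝ) (u : ℝ → Vec d → Vec N) : Prop where
  contDiffOn : ContDiffOn ℝ 2 (fun p : ℝ × Vec d => u p.1 p.2) (I ×ˢ Set.univ)
  equation : ∀ t ∈ I, ∀ (x : Vec d) (j : Fin N),
    iteratedDerivWithin 2 (fun s => u s x j) I t
        - Laplacian.laplacian (fun y => u t y j) x + m j ^ 2 * u t x j
      = F (u t x) (timeDeriv I u t x) (spaceDeriv u t x) j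

/-- Uniqueness of classical solutions of the initial value problem: two classical solutions on
a common (nondegenerate) time interval that have the same Cauchy data `(u, ∂ₜ u)` at some time
of the interval coincide on the whole interval. -/
def UniqueClassicalSolutions {N d : ℕ} (m : Fin N → ℝ)
    (F : Vec N → Vec N → Matrix (Fin N) (Fin d) ℝ → Vec N) : Prop :=
  ∀ I : Set ℝ, I.OrdConnected → I.Nontrivial →
    ∀ u₁ u₂ : ℝ → Vec d → Vec N,
      IsClassicalSolution m F I u₁ → IsClassicalSolution m F I u₂ →
      ∀ t₀ ∈ I, (∀ x, u₁ t₀ x = u₂ t₀ x) →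
        (∀ x, timeDeriv I u₁ t₀ x = timeDeriv I u₂ t₀ x) →
        ∀ t ∈ I, ∀ x, u₁ t x = u₂ t x

/-- The decay rate `t ^ (-d/2) (log t) ^ (-d/2)` (used for `t > 1` only). -/
def rate (d : ℕ) (t : ℝ) : ℝ :=
  t ^ (-((d : ℝ) / 2)) * Real.log t ^ (-((d : ℝ) / 2))

/-- The norm of `L^∞(ℝ^d)` in the space variable, as an extended nonnegative number. -/
def supNorm {d : ℕ} {E : Type*} [NormedAddCommGroup E] (f : Vec d → E) : ENNReal :=
  eLpNorm f ⊤ (volume : Measure (Vec d))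

end KleinGordon

end

/-!
The idea is an energy estimate backwards in time in which only `∂ₜ u` has to be small. The energy
`E(t)` of `u` in an expanding cone `|x - x₀| < t + c` loses nothing through the boundary of the
cone, so `E'` is at least `2 ∫ ∂ₜ u · F`. The density `|∂ₜ u| |F|` is estimated with `a = |∂ₜ u|`
and `S` the size of the whole jet `(u, ∂ₜ u, D u)`: since `a ≤ S`, `a S ^ (1 + 2 / d) ≤ (a S) ^ (1
/ d) S ^ 2`, and `a S = o(rate ^ 2) = o((t log t) ^ (-d))`. Hence `E' ≥ -q E / (t log t)` for late
`t`, with `q > 0` as small as desired. It suffices to take `q = d / 2`: then `E (log t) ^ (d / 2)`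
is nondecreasing, while integrating the decay hypothesis over a ball of radius `O(t)` gives `E =
O((log t) ^ (-d))`. So `E` vanishes at all late times, hence so does `u`, and uniqueness for the
initial value problem extends this to the whole interval.

Since `u` need not have finite energy, everything is localized by `coneWeight`, a smooth function
of `t + c - √(1 + |x - x₀|²)` whose space gradient is bounded by its time derivative
(`isCausalWeight_coneWeight`); this replaces the boundary terms on the light cone and keeps all
integrands compactly supported. The energy inequality is `IsCausalWeight.neg_mul_energy_le`, the
estimate of the forcing is `neg_mul_energyDensity_le` (through `mul_rpow_critical_le`), and the
argument in `t` is `nonpos_of_log_gronwall`.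
-/

noncomputable section

namespace KleinGordon

open MeasureTheory Metric Set Filter Topology

/-! ### Integrals over time slices of a cone -/

/-- The directional derivative of `f` along the constant vector field `v`. -/
def pd {E : Type*} [NormedAddCommGroup E] [NormedSpace ℝ E] (f : E → ℝ) (v p : E) : ℝ :=
  fderiv ℝ f p v

lemma _root_.HasFDerivAt.pd_eq {E : Type*} [NormedAddCommGroup E] [NormedSpace ℝ E] {f : E → ℝ}
    {L : E →L[ℝ] ℝ} {p : E} (h : HasFDerivAt f L p) (v : E) : pd f v p = L v := by
  rw [pd, h.fderiv]

lemma fderiv_apply_eq_pd {E : Type*} [NormedAddCommGroup E] [NormedSpace ℝ E] (f : E → ℝ)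
    (v p : E) : fderiv ℝ f p v = pd f v p := rfl

/-- The unit vector in the time direction of space-time. -/
abbrev eT (d : ℕ) : ℝ × Vec d := (1, 0)

/-- The unit vector in the `k`-th space direction of space-time. -/
abbrev eX {d : ℕ} (k : Fin d) : ℝ × Vec d := (0, EuclideanSpace.single k 1)

/-- The open half of space-time after time `T`. -/
abbrev future (d : ℕ) (T : ℝ) : Set (ℝ × Vec d) := Ioi T ×ˢ univ

lemma isOpen_future (d : ℕ) (T : ℝ) : IsOpen (future d T) := isOpen_Ioi.prod isOpen_univ

lemma mem_future {d : ℕ} {T t : ℝ} (ht : T < t) (x : Vec d) : (t, x) ∈ future d T :=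
  ⟨ht, mem_univ x⟩

section Slices

variable {d : ℕ} {T : ℝ} {f : ℝ × Vec d → ℝ}

lemma contDiff_slice {n : WithTop ℕ∞} (hf : ContDiffOn ℝ n f (future d T)) {t : ℝ} (ht : T < t) :
    ContDiff ℝ n fun x => f (t, x) := by
  rw [← contDiffOn_univ]
  exact hf.comp (contDiff_prodMk_right t).contDiffOn fun x _ => mem_future ht x

lemma differentiableAt_of_mem_future (hf : ContDiffOn ℝ 1 f (future d T)) {p : ℝ × Vec d}
    (hp : p ∈ future d T) : DifferentiableAt ℝ f p :=
  (hf.differentiableOn (by simp)).differentiableAt ((isOpen_future d T).mem_nhds hp)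

lemma hasFDerivAt_slice_space (hf : ContDiffOn ℝ 1 f (future d T)) {t : ℝ} (ht : T < t)
    (x : Vec d) :
    HasFDerivAt (fun y => f (t, y))
      ((fderiv ℝ f (t, x)).comp (ContinuousLinearMap.inr ℝ ℝ (Vec d))) x :=
  (differentiableAt_of_mem_future hf (mem_future ht x)).hasFDerivAt.comp x
    (hasFDerivAt_prodMk_right t x)

lemma fderiv_slice_space (hf : ContDiffOn ℝ 1 f (future d T)) {t : ℝ} (ht : T < t)
    (x v : Vec d) : fderiv ℝ (fun y => f (t, y)) x v = pd f (0, v) (t, x) := by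
  rw [(hasFDerivAt_slice_space hf ht x).fderiv]
  simp [pd]

lemma hasDerivAt_slice_time (hf : ContDiffOn ℝ 1 f (future d T)) {t : ℝ} (ht : T < t)
    (x : Vec d) : HasDerivAt (fun s => f (s, x)) (pd f (eT d) (t, x)) t := by
  have h := ((differentiableAt_of_mem_future hf (mem_future ht x)).hasFDerivAt.comp t
    (hasFDerivAt_prodMk_left t x)).hasDerivAt
  simpa [pd, Function.comp_def] using h

lemma contDiffOn_pd {n : WithTop ℕ∞} (hf : ContDiffOn ℝ (n + 1) f (future d T))
    (v : ℝ × Vec d) : ContDiffOn ℝ n (pd f v) (future d T) :=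
  (hf.fderiv_of_isOpen (isOpen_future d T) le_rfl).clm_apply contDiffOn_const

lemma continuousOn_pd (hf : ContDiffOn ℝ 1 f (future d T)) (v : ℝ × Vec d) :
    ContinuousOn (pd f v) (future d T) :=
  (contDiffOn_pd (n := 0) (by simpa using hf) v).continuousOn

lemma continuous_slice_pd (hf : ContDiffOn ℝ 1 f (future d T)) (v : ℝ × Vec d) {t : ℝ}
    (ht : T < t) : Continuous fun x => pd f v (t, x) :=
  (contDiff_slice (contDiffOn_pd (n := 0) (by simpa using hf) v) ht).continuous

end Slices

section Cone

variable {d : ℕ} {T c : ℝ} {x₀ : Vec d} {f : ℝ × Vec d → ℝ}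

/-- `f` vanishes outside the expanding cone `|x - x₀| ≤ t + c`. -/
def SupportedInCone (c : ℝ) (x₀ : Vec d) (f : ℝ × Vec d → ℝ) : Prop :=
  ∀ t x, t + c < dist x x₀ → f (t, x) = 0

lemma SupportedInCone.mul_right (h : SupportedInCone c x₀ f) (g : ℝ × Vec d → ℝ) :
    SupportedInCone c x₀ fun p => f p * g p := fun t x hx => by simp [h t x hx]

lemma SupportedInCone.pd (h : SupportedInCone c x₀ f) (v : ℝ × Vec d) :
    SupportedInCone c x₀ (pd f v) := by
  intro t x hx
  have ho : IsOpen {p : ℝ × Vec d | p.1 + c < dist p.2 x₀} :=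
    isOpen_lt (by fun_prop) (by fun_prop)
  have he : f =ᶠ[𝓝 (t, x)] fun _ => 0 := by
    filter_upwards [ho.mem_nhds (show (t, x) ∈ {p : ℝ × Vec d | p.1 + c < dist p.2 x₀} from hx)]
      with p hp using h p.1 p.2 hp
  simp [KleinGordon.pd, he.fderiv_eq]

lemma SupportedInCone.hasCompactSupport_slice (h : SupportedInCone c x₀ f) (t : ℝ) :
    HasCompactSupport fun x => f (t, x) :=
  HasCompactSupport.intro (isCompact_closedBall x₀ (t + c)) fun x hx =>
    h t x (by simpa using hx)

lemma integrable_slice (hf : ContinuousOn f (future d T)) (h : SupportedInCone c x₀ f) {t : ℝ}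
    (ht : T < t) : Integrable fun x => f (t, x) :=
  Continuous.integrable_of_hasCompactSupport
    (hf.comp_continuous (by fun_prop) fun x => mem_future ht x) (h.hasCompactSupport_slice t)

/-- Differentiation under the integral sign over time slices of a cone. -/
lemma hasDerivAt_integral_slice (hf : ContDiffOn ℝ 1 f (future d T))
    (h : SupportedInCone c x₀ f) {t : ℝ} (ht : T < t) :
    HasDerivAt (fun s => ∫ x, f (s, x)) (∫ x, pd f (eT d) (t, x)) t := by
  obtain ⟨δ, hδ, hδT⟩ : ∃ δ > 0, T < t - δ := ⟨(t - T) / 2, by linarith, by linarith⟩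
  set K : Set (ℝ × Vec d) := Icc (t - δ) (t + δ) ×ˢ closedBall x₀ (t + δ + c)
  have hK : IsCompact K := isCompact_Icc.prod (isCompact_closedBall _ _)
  have hKU : K ⊆ future d T := fun p hp => ⟨hδT.trans_le hp.1.1, mem_univ _⟩
  obtain ⟨M, hM⟩ := hK.exists_bound_of_continuousOn ((continuousOn_pd hf (eT d)).mono hKU)
  refine (hasDerivAt_integral_of_dominated_loc_of_deriv_le
    (s := Icc (t - δ) (t + δ)) (F := fun s x => f (s, x)) (F' := fun s x => pd f (eT d) (s, x))
    (bound := (closedBall x₀ (t + δ + c)).indicator fun _ => M)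
    (Icc_mem_nhds (by linarith) (by linarith)) ?_ (integrable_slice hf.continuousOn h ht) ?_
    ?_ ?_ ?_).2
  · filter_upwards [lt_mem_nhds ht] with s hs
    exact (contDiff_slice hf hs).continuous.aestronglyMeasurable
  · exact (continuous_slice_pd hf _ ht).aestronglyMeasurable
  · refine Eventually.of_forall fun x s hs => ?_
    by_cases hx : x ∈ closedBall x₀ (t + δ + c)
    · rw [indicator_of_mem hx]
      exact hM (s, x) ⟨hs, hx⟩
    · rw [indicator_of_notMem hx, h.pd (eT d) s x, norm_zero]
      rw [mem_closedBall, not_le] at hx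
      linarith [hs.2]
  · exact (integrable_indicator_iff measurableSet_closedBall).2
      (integrableOn_const (measure_closedBall_lt_top.ne))
  · exact Eventually.of_forall fun x s hs => hasDerivAt_slice_time hf (hδT.trans_le hs.1) x

lemma integral_pd_space_eq_zero (hf : ContDiffOn ℝ 1 f (future d T))
    (h : SupportedInCone c x₀ f) {t : ℝ} (ht : T < t) (v : Vec d) :
    ∫ x, pd f (0, v) (t, x) = 0 := by
  have hint := integrable_slice (continuousOn_pd hf (0, v)) (h.pd _) ht
  have := integral_mul_fderiv_eq_neg_fderiv_mul_of_integrable (μ := (volume : Measure (Vec d)))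
    (f := fun _ => (1 : ℝ)) (g := fun x => f (t, x)) (v := v) (by simp)
    (by simpa [fderiv_slice_space hf ht] using hint)
    (by simpa using integrable_slice hf.continuousOn h ht) (by simp)
    (fun x _ => ((contDiff_slice hf ht).differentiable (by simp)) x)
  simpa [fderiv_slice_space hf ht] using this

/-- A density `f` with flux `P`, both supported in a cone and almost satisfying a conservation
law, decreases at most at the relative rate `κ`: the flux integrates to zero. -/
lemma neg_mul_integral_le_of_flux {P : Fin d → ℝ × Vec d → ℝ}
    (hf : ContDiffOn ℝ 1 f (future d T)) (h : SupportedInCone c x₀ f)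
    (hP : ∀ k, ContDiffOn ℝ 1 (P k) (future d T)) (hPs : ∀ k, SupportedInCone c x₀ (P k))
    {t κ : ℝ} (ht : T < t)
    (hκ : ∀ᵐ x : Vec d, -κ * f (t, x) ≤ pd f (eT d) (t, x) - ∑ k, pd (P k) (eX k) (t, x)) :
    -κ * ∫ x, f (t, x) ≤ ∫ x, pd f (eT d) (t, x) := by
  have hPi : ∀ k, Integrable fun x => pd (P k) (eX k) (t, x) := fun k =>
    integrable_slice (continuousOn_pd (hP k) _) ((hPs k).pd _) ht
  have hfi : Integrable fun x => pd f (eT d) (t, x) :=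
    integrable_slice (continuousOn_pd hf _) (h.pd _) ht
  have hsum : ∫ x, ∑ k, pd (P k) (eX k) (t, x) = 0 := by
    rw [integral_finsetSum _ fun k _ => hPi k]
    exact Finset.sum_eq_zero fun k _ => integral_pd_space_eq_zero (hP k) (hPs k) ht _
  calc -κ * ∫ x, f (t, x) = ∫ x, -κ * f (t, x) := (integral_const_mul _ _).symm
    _ ≤ ∫ x, (pd f (eT d) (t, x) - ∑ k, pd (P k) (eX k) (t, x)) :=
        integral_mono_ae ((integrable_slice hf.continuousOn h ht).const_mul _)
          (hfi.sub (integrable_finsetSum _ fun k _ => hPi k)) hκ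
    _ = ∫ x, pd f (eT d) (t, x) := by
        rw [integral_sub hfi (integrable_finsetSum _ fun k _ => hPi k), hsum, sub_zero]

end Cone

/-! ### The weighted energy inequality -/

section Energy

variable {N d : ℕ} {T c : ℝ} {x₀ : Vec d}

/-- The energy density `Σⱼ (|∂ₜ wⱼ|² + |∇ wⱼ|² + mⱼ² wⱼ²)`, without the factor `1/2`. -/
def energyDensity (m : Fin N → ℝ) (w : Fin N → ℝ × Vec d → ℝ) (p : ℝ × Vec d) : ℝ :=
  ∑ j, (pd (w j) (eT d) p ^ 2 + ∑ k, pd (w j) (eX k) p ^ 2 + m j ^ 2 * w j p ^ 2)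

/-- The energy flux `2 Σⱼ ∂ₜ wⱼ ∂ₖ wⱼ` in the `k`-th space direction. -/
def energyFlux (w : Fin N → ℝ × Vec d → ℝ) (k : Fin d) (p : ℝ × Vec d) : ℝ :=
  ∑ j, 2 * (pd (w j) (eT d) p * pd (w j) (eX k) p)

/-- The Klein–Gordon operator `∂ₜ² - Δ + μ²`. -/
def kleinGordonOp (μ : ℝ) (w : ℝ × Vec d → ℝ) (p : ℝ × Vec d) : ℝ :=
  pd (pd w (eT d)) (eT d) p - ∑ k, pd (pd w (eX k)) (eX k) p + μ ^ 2 * w p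

variable {m : Fin N → ℝ} {w : Fin N → ℝ × Vec d → ℝ}

lemma energyDensity_nonneg (m : Fin N → ℝ) (w : Fin N → ℝ × Vec d → ℝ) (p : ℝ × Vec d) :
    0 ≤ energyDensity m w p := by
  unfold energyDensity; positivity

lemma contDiffOn_energyDensity (m : Fin N → ℝ) (hw : ∀ j, ContDiffOn ℝ 2 (w j) (future d T)) :
    ContDiffOn ℝ 1 (energyDensity m w) (future d T) := by
  have h1 : ∀ j v, ContDiffOn ℝ 1 (pd (w j) v) (future d T) := fun j v =>
    contDiffOn_pd (by simpa [one_add_one_eq_two] using hw j) v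
  have h0 : ∀ j, ContDiffOn ℝ 1 (w j) (future d T) := fun j => (hw j).of_le (by norm_num)
  exact ContDiffOn.sum fun j _ => (((h1 j _).pow 2).add (ContDiffOn.sum fun k _ =>
    (h1 j _).pow 2)).add (contDiffOn_const.mul ((h0 j).pow 2))

lemma contDiffOn_energyFlux (hw : ∀ j, ContDiffOn ℝ 2 (w j) (future d T)) (k : Fin d) :
    ContDiffOn ℝ 1 (energyFlux w k) (future d T) := by
  have h1 : ∀ j v, ContDiffOn ℝ 1 (pd (w j) v) (future d T) := fun j v =>
    contDiffOn_pd (by simpa [one_add_one_eq_two] using hw j) v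
  exact ContDiffOn.sum fun j _ => contDiffOn_const.mul ((h1 j _).mul (h1 j _))

lemma pd_pd_comm {f : ℝ × Vec d → ℝ} (hf : ContDiffOn ℝ 2 f (future d T)) {p : ℝ × Vec d}
    (hp : p ∈ future d T) (v v' : ℝ × Vec d) : pd (pd f v) v' p = pd (pd f v') v p := by
  have hfp : ContDiffAt ℝ 2 f p := hf.contDiffAt ((isOpen_future d T).mem_nhds hp)
  have hd : DifferentiableAt ℝ (fderiv ℝ f) p :=
    (hfp.fderiv_right (m := 1) (by norm_num)).differentiableAt (by simp)
  have key : ∀ a b, pd (pd f a) b p = fderiv ℝ (fderiv ℝ f) p b a := fun a b => by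
    change fderiv ℝ (fun q => fderiv ℝ f q a) p b = _
    rw [fderiv_clm_apply hd (differentiableAt_const a)]
    simp
  rw [key, key]
  exact hfp.isSymmSndFDerivAt (by simp) v' v

/-- The local energy identity. -/
lemma pd_energyDensity_sub_flux (hw : ∀ j, ContDiffOn ℝ 2 (w j) (future d T)) {p : ℝ × Vec d}
    (hp : p ∈ future d T) :
    pd (energyDensity m w) (eT d) p - ∑ k, pd (energyFlux w k) (eX k) p
      = ∑ j, 2 * (pd (w j) (eT d) p * kleinGordonOp (m j) (w j) p) := by
  have h1 : ∀ j v, HasFDerivAt (pd (w j) v) (fderiv ℝ (pd (w j) v) p) p := fun j v =>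
    (differentiableAt_of_mem_future (contDiffOn_pd (by simpa [one_add_one_eq_two] using hw j) v)
      hp).hasFDerivAt
  have h0 : ∀ j, HasFDerivAt (w j) (fderiv ℝ (w j) p) p := fun j =>
    (differentiableAt_of_mem_future ((hw j).of_le (by norm_num)) hp).hasFDerivAt
  have hE : pd (energyDensity m w) (eT d) p = ∑ j, (2 * (pd (w j) (eT d) p *
      pd (pd (w j) (eT d)) (eT d) p) + ∑ k, 2 * (pd (w j) (eX k) p *
      pd (pd (w j) (eX k)) (eT d) p) + m j ^ 2 * (2 * (w j p * pd (w j) (eT d) p))) := by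
    have := HasFDerivAt.fun_sum (u := Finset.univ) fun j _ =>
      (((h1 j (eT d)).pow 2).add (HasFDerivAt.fun_sum (u := Finset.univ) fun k _ =>
      (h1 j (eX k)).pow 2)).add (((h0 j).pow 2).const_mul (m j ^ 2))
    exact (this.pd_eq (eT d)).trans (by simp [fderiv_apply_eq_pd, mul_assoc])
  have hP : ∀ k, pd (energyFlux w k) (eX k) p = ∑ j, 2 * (pd (w j) (eT d) p *
      pd (pd (w j) (eX k)) (eX k) p + pd (w j) (eX k) p * pd (pd (w j) (eT d)) (eX k) p) := by
    intro k
    have := HasFDerivAt.fun_sum (u := Finset.univ) fun j _ =>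
      (((h1 j (eT d)).mul (h1 j (eX k))).const_mul 2)
    exact (this.pd_eq (eX k)).trans (by simp [fderiv_apply_eq_pd, mul_add])
  rw [hE, Finset.sum_congr rfl fun k _ => hP k, Finset.sum_comm, ← Finset.sum_sub_distrib]
  refine Finset.sum_congr rfl fun j _ => ?_
  simp only [kleinGordonOp, pd_pd_comm (hw j) hp (eT d) (eX _), mul_add, Finset.sum_add_distrib,
    mul_sub, ← Finset.mul_sum]
  ring

/-- A `C¹` weight with values in `[0, 1]`, supported in an expanding cone, whose space gradient is
bounded by its time derivative. As for the indicator of an expanding light cone, the variation of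
such a weight can only increase the weighted energy in time. -/
structure IsCausalWeight (c : ℝ) (x₀ : Vec d) (φ : ℝ × Vec d → ℝ) : Prop where
  contDiff : ContDiff ℝ 1 φ
  nonneg : ∀ p, 0 ≤ φ p
  le_one : ∀ p, φ p ≤ 1
  supported : SupportedInCone c x₀ φ
  pd_nonneg : ∀ p, 0 ≤ pd φ (eT d) p
  grad_le : ∀ p, ∑ k, pd φ (eX k) p ^ 2 ≤ pd φ (eT d) p ^ 2

/-- The flux caused by the variation of the weight in space is dominated by the gain caused by its
variation in time, by the Cauchy–Schwarz inequality. -/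
lemma IsCausalWeight.sum_flux_le {φ : ℝ × Vec d → ℝ} (hφ : IsCausalWeight c x₀ φ)
    (m : Fin N → ℝ) (w : Fin N → ℝ × Vec d → ℝ) (p : ℝ × Vec d) :
    ∑ k, pd φ (eX k) p * energyFlux w k p ≤ pd φ (eT d) p * energyDensity m w p := by
  simp only [energyFlux, energyDensity, Finset.mul_sum]
  rw [Finset.sum_comm]
  refine Finset.sum_le_sum fun j _ => ?_
  set b := pd φ (eT d) p
  set a := pd (w j) (eT d) p
  set S := ∑ k, pd (w j) (eX k) p ^ 2
  set Q := ∑ k, pd φ (eX k) p * pd (w j) (eX k) p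
  have hb : 0 ≤ b := hφ.pd_nonneg p
  have hS : 0 ≤ S := by positivity
  have hQ : Q ^ 2 ≤ b ^ 2 * S :=
    (Finset.sum_mul_sq_le_sq_mul_sq _ _ _).trans (by gcongr; exact hφ.grad_le p)
  have h1 : ∑ k, pd φ (eX k) p * (2 * (a * pd (w j) (eX k) p)) = 2 * a * Q := by
    rw [Finset.mul_sum]
    exact Finset.sum_congr rfl fun k _ => by ring
  have h2 : 2 * a * Q ≤ b * (a ^ 2 + S) := by
    refine abs_le_of_sq_le_sq' ?_ (by positivity) |>.2
    have : a ^ 2 * Q ^ 2 ≤ a ^ 2 * (b ^ 2 * S) := by gcongr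
    nlinarith [mul_nonneg (sq_nonneg b) (sq_nonneg (a ^ 2 - S))]
  rw [h1]
  have : 0 ≤ b * (m j ^ 2 * w j p ^ 2) := by positivity
  linarith

/-- The weighted energy decreases at most at the relative rate `κ` if the forcing is controlled
by the energy density. -/
lemma IsCausalWeight.neg_mul_energy_le {φ : ℝ × Vec d → ℝ} (hφ : IsCausalWeight c x₀ φ)
    (hw : ∀ j, ContDiffOn ℝ 2 (w j) (future d T)) {t κ : ℝ} (ht : T < t)
    (hκ : ∀ᵐ x : Vec d, -κ * energyDensity m w (t, x) ≤
      ∑ j, 2 * (pd (w j) (eT d) (t, x) * kleinGordonOp (m j) (w j) (t, x))) :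
    -κ * ∫ x, φ (t, x) * energyDensity m w (t, x) ≤
      ∫ x, pd (fun p => φ p * energyDensity m w p) (eT d) (t, x) := by
  have hE := contDiffOn_energyDensity m hw
  have hF := contDiffOn_energyFlux hw
  have hφ1 : ContDiffOn ℝ 1 φ (future d T) := hφ.contDiff.contDiffOn
  refine neg_mul_integral_le_of_flux (f := fun p => φ p * energyDensity m w p)
    (P := fun k p => φ p * energyFlux w k p) (hφ1.mul hE)
    (hφ.supported.mul_right _) (fun k => hφ1.mul (hF k)) (fun k => hφ.supported.mul_right _) ht ?_
  filter_upwards [hκ] with x hx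
  have hp := mem_future (d := d) ht x
  have hmul : ∀ (g : ℝ × Vec d → ℝ) v, ContDiffOn ℝ 1 g (future d T) →
      pd (fun p => φ p * g p) v (t, x) = φ (t, x) * pd g v (t, x) + pd φ v (t, x) * g (t, x) := by
    intro g v hg
    unfold pd
    rw [fderiv_fun_mul (differentiableAt_of_mem_future hφ1 hp)
      (differentiableAt_of_mem_future hg hp)]
    simp [mul_comm]
  rw [hmul _ _ hE, Finset.sum_congr rfl fun k _ => hmul _ _ (hF k), Finset.sum_add_distrib,
    ← Finset.mul_sum]
  have h1 := pd_energyDensity_sub_flux (m := m) hw hp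
  have h2 := hφ.sum_flux_le m w (t, x)
  have h3 := mul_le_mul_of_nonneg_left (hx.trans_eq h1.symm) (hφ.nonneg (t, x))
  linarith

end Energy

/-! ### A causal weight -/

section Weight

variable {d : ℕ}

lemma hasFDerivAt_japaneseBracket (x₀ x : Vec d) :
    HasFDerivAt (fun y : Vec d => √(1 + ‖y - x₀‖ ^ 2))
      ((√(1 + ‖x - x₀‖ ^ 2))⁻¹ • innerSL ℝ (x - x₀)) x := by
  have hpos : 0 < 1 + ‖x - x₀‖ ^ 2 := by positivity
  have h1 : HasFDerivAt (fun y : Vec d => ‖y - x₀‖ ^ 2) (2 • innerSL ℝ (x - x₀)) x :=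
    ((hasFDerivAt_id x).sub_const x₀).norm_sq
  refine ((h1.const_add 1).sqrt hpos.ne').congr_fderiv ?_
  rw [← Nat.cast_smul_eq_nsmul ℝ, smul_smul]
  congr 1
  field_simp
  norm_num

/-- A smoothed indicator of the expanding cone `|x - x₀| < t + c`. The bracket
`√(1 + |x - x₀|²)` replaces `|x - x₀|` to keep it smooth at the axis. -/
def coneWeight (c : ℝ) (x₀ : Vec d) (p : ℝ × Vec d) : ℝ :=
  Real.smoothTransition (p.1 + c - √(1 + ‖p.2 - x₀‖ ^ 2))

lemma isCausalWeight_coneWeight (c : ℝ) (x₀ : Vec d) :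
    IsCausalWeight c x₀ (coneWeight c x₀) := by
  have hder : ∀ p v, pd (coneWeight c x₀) v p =
      deriv Real.smoothTransition (p.1 + c - √(1 + ‖p.2 - x₀‖ ^ 2)) *
        (v.1 - (√(1 + ‖p.2 - x₀‖ ^ 2))⁻¹ * inner ℝ (p.2 - x₀) v.2) := by
    intro p v
    have h1 := ((Real.smoothTransition.contDiff (n := 1)).differentiable (by simp)
      (p.1 + c - √(1 + ‖p.2 - x₀‖ ^ 2))).hasDerivAt
    have h2 : HasFDerivAt (fun q : ℝ × Vec d => q.1 + c - √(1 + ‖q.2 - x₀‖ ^ 2)) _ p :=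
      (hasFDerivAt_fst.add_const c).sub
        ((hasFDerivAt_japaneseBracket x₀ p.2).comp p hasFDerivAt_snd)
    have h3 := h1.comp_hasFDerivAt p h2
    exact (h3.pd_eq v).trans (by simp [inner_sub_left])
  have hmono : ∀ s, 0 ≤ deriv Real.smoothTransition s := fun s =>
    Real.smoothTransition.monotone.deriv_nonneg
  refine ⟨?_, fun p => Real.smoothTransition.nonneg _, fun p => Real.smoothTransition.le_one _,
    ?_, ?_, ?_⟩
  · refine (Real.smoothTransition.contDiff (n := 1)).comp ((contDiff_fst.add contDiff_const).sub
      (ContDiff.sqrt (contDiff_const.add ((contDiff_snd.sub contDiff_const).norm_sq ℝ)) ?_))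
    intro p; positivity
  · intro t x hx
    refine Real.smoothTransition.zero_of_nonpos ?_
    rw [dist_eq_norm] at hx
    have : ‖x - x₀‖ ≤ √(1 + ‖x - x₀‖ ^ 2) := Real.le_sqrt_of_sq_le (by linarith)
    simp only
    linarith
  · intro p
    rw [hder]
    simpa using hmono _
  · intro p
    simp only [hder]
    simp only [EuclideanSpace.inner_single_right, zero_sub, inner_zero_right, mul_zero,
      sub_zero, mul_one, mul_neg, neg_sq, mul_pow, conj_trivial, one_mul]
    rw [← Finset.mul_sum, ← Finset.mul_sum]
    refine mul_le_of_le_one_right (sq_nonneg _) ?_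
    rw [← EuclideanSpace.real_norm_sq_eq, inv_pow, Real.sq_sqrt (by positivity),
      inv_mul_le_iff₀ (by positivity)]
    linarith

end Weight

/-! ### From the system to its components -/

section Components

variable {N d : ℕ} {T : ℝ} {u : ℝ → Vec d → Vec N}

/-- The components of `u` as functions on space-time. -/
def component (u : ℝ → Vec d → Vec N) (j : Fin N) (p : ℝ × Vec d) : ℝ := u p.1 p.2 j

lemma contDiffOn_component
    (hu : ContDiffOn ℝ 2 (fun p : ℝ × Vec d => u p.1 p.2) (Ici T ×ˢ univ)) (j : Fin N) :
    ContDiffOn ℝ 2 (component u j) (future d T) :=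
  (EuclideanSpace.proj (𝕜 := ℝ) j).contDiff.comp_contDiffOn
    (hu.mono (prod_mono_left Ioi_subset_Ici_self))

lemma timeDeriv_apply (hu : ContDiffOn ℝ 2 (fun p : ℝ × Vec d => u p.1 p.2) (Ici T ×ˢ univ))
    {t : ℝ} (ht : T < t) (x : Vec d) (j : Fin N) :
    timeDeriv (Ici T) u t x j = pd (component u j) (eT d) (t, x) := by
  have hd : DifferentiableAt ℝ (fun p : ℝ × Vec d => u p.1 p.2) (t, x) :=
    ((hu.mono (prod_mono_left Ioi_subset_Ici_self)).differentiableOn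
      (by simp)).differentiableAt ((isOpen_future d T).mem_nhds (mem_future ht x))
  have h1 : HasDerivAt (fun s => u s x)
      (fderiv ℝ (fun p : ℝ × Vec d => u p.1 p.2) (t, x) (1, 0)) t := by
    simpa [Function.comp_def] using
      (hd.hasFDerivAt.comp t (hasFDerivAt_prodMk_left t x)).hasDerivAt
  have h2 : HasFDerivAt (component u j) ((EuclideanSpace.proj (𝕜 := ℝ) j).comp
      (fderiv ℝ (fun p : ℝ × Vec d => u p.1 p.2) (t, x))) (t, x) :=
    (EuclideanSpace.proj (𝕜 := ℝ) j).hasFDerivAt.comp (t, x) hd.hasFDerivAt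
  rw [timeDeriv, derivWithin_of_mem_nhds (Ici_mem_nhds ht), h1.deriv, h2.pd_eq]
  rfl

lemma spaceDeriv_apply (hu : ContDiffOn ℝ 2 (fun p : ℝ × Vec d => u p.1 p.2) (Ici T ×ˢ univ))
    {t : ℝ} (ht : T < t) (x : Vec d) (j : Fin N) (k : Fin d) :
    spaceDeriv u t x j k = pd (component u j) (eX k) (t, x) :=
  fderiv_slice_space ((contDiffOn_component hu j).of_le (by norm_num)) ht x _

lemma contDiffOn_pd_component
    (hu : ContDiffOn ℝ 2 (fun p : ℝ × Vec d => u p.1 p.2) (Ici T ×ˢ univ)) (j : Fin N)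
    (v : ℝ × Vec d) : ContDiffOn ℝ 1 (pd (component u j) v) (future d T) :=
  contDiffOn_pd (by simpa [one_add_one_eq_two] using contDiffOn_component hu j) v

lemma iteratedDerivWithin_component
    (hu : ContDiffOn ℝ 2 (fun p : ℝ × Vec d => u p.1 p.2) (Ici T ×ˢ univ))
    {t : ℝ} (ht : T < t) (x : Vec d) (j : Fin N) :
    iteratedDerivWithin 2 (fun s => u s x j) (Ici T) t
      = pd (pd (component u j) (eT d)) (eT d) (t, x) := by
  have h1 := (contDiffOn_component hu j).of_le (m := 1) (by norm_num)
  have he : iteratedDerivWithin 1 (fun s => u s x j) (Ici T)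
      =ᶠ[𝓝 t] fun s => pd (component u j) (eT d) (s, x) := by
    filter_upwards [lt_mem_nhds ht] with s hs
    rw [iteratedDerivWithin_one, derivWithin_of_mem_nhds (Ici_mem_nhds hs)]
    exact (hasDerivAt_slice_time h1 hs x).deriv
  rw [iteratedDerivWithin_succ, derivWithin_of_mem_nhds (Ici_mem_nhds ht), he.deriv_eq]
  exact (hasDerivAt_slice_time (contDiffOn_pd_component hu j _) ht x).deriv

lemma laplacian_component
    (hu : ContDiffOn ℝ 2 (fun p : ℝ × Vec d => u p.1 p.2) (Ici T ×ˢ univ))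
    {t : ℝ} (ht : T < t) (x : Vec d) (j : Fin N) :
    Laplacian.laplacian (fun y => u t y j) x
      = ∑ k, pd (pd (component u j) (eX k)) (eX k) (t, x) := by
  have h2 := contDiffOn_component hu j
  have hs : ContDiff ℝ 2 fun y => u t y j := contDiff_slice h2 ht
  have hd : Differentiable ℝ (fderiv ℝ fun y => u t y j) :=
    (hs.fderiv_right (m := 1) (by norm_num)).differentiable (by simp)
  rw [InnerProductSpace.laplacian_eq_iteratedFDeriv_orthonormalBasis _
    (EuclideanSpace.basisFun (Fin d) ℝ)]
  refine Finset.sum_congr rfl fun k _ => ?_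
  have hk : (fun y => fderiv ℝ (fun y => u t y j) y (EuclideanSpace.single k 1))
      = fun y => pd (component u j) (eX k) (t, y) :=
    funext fun y => fderiv_slice_space (h2.of_le (by norm_num)) ht y _
  rw [← fderiv_slice_space (contDiffOn_pd_component hu j _) ht, ← hk,
    fderiv_clm_apply (hd x) (differentiableAt_const _), iteratedFDeriv_two_apply]
  simp

lemma IsClassicalSolution.kleinGordonOp_component {m : Fin N → ℝ}
    {F : Vec N → Vec N → Matrix (Fin N) (Fin d) ℝ → Vec N}
    (hu : IsClassicalSolution m F (Ici T) u) {t : ℝ} (ht : T < t) (x : Vec d) (j : Fin N) :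
    kleinGordonOp (m j) (component u j) (t, x)
      = F (u t x) (timeDeriv (Ici T) u t x) (spaceDeriv u t x) j := by
  rw [← hu.equation t ht.le x j, iteratedDerivWithin_component hu.contDiffOn ht,
    laplacian_component hu.contDiffOn ht]
  rfl

/-- The square `|u|² + |∂ₜ u|² + |D u|²` of the size of the first-order jet of `u`. -/
def jetSq (T : ℝ) (u : ℝ → Vec d → Vec N) (t : ℝ) (x : Vec d) : ℝ :=
  ‖u t x‖ ^ 2 + ‖timeDeriv (Ici T) u t x‖ ^ 2 + frob (spaceDeriv u t x) ^ 2

lemma jetSq_eq_sum (hu : ContDiffOn ℝ 2 (fun p : ℝ × Vec d => u p.1 p.2) (Ici T ×ˢ univ))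
    {t : ℝ} (ht : T < t) (x : Vec d) :
    jetSq T u t x = ∑ j, (component u j (t, x) ^ 2 + pd (component u j) (eT d) (t, x) ^ 2
      + ∑ k, pd (component u j) (eX k) (t, x) ^ 2) := by
  rw [jetSq, frob, Real.sq_sqrt (by positivity), EuclideanSpace.real_norm_sq_eq,
    EuclideanSpace.real_norm_sq_eq]
  simp only [timeDeriv_apply hu ht, spaceDeriv_apply hu ht, Finset.sum_add_distrib]
  rfl

lemma exists_jetSq_le (hu : ContDiffOn ℝ 2 (fun p : ℝ × Vec d => u p.1 p.2) (Ici T ×ˢ univ))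
    {m : Fin N → ℝ} (hm : ∀ j, 0 < m j) :
    ∃ K > 0, ∀ t, T < t → ∀ x, jetSq T u t x ≤ K * energyDensity m (component u) (t, x) := by
  refine ⟨1 + ∑ j, (m j ^ 2)⁻¹, by positivity, fun t ht x => ?_⟩
  rw [jetSq_eq_sum hu ht, energyDensity, Finset.mul_sum]
  refine Finset.sum_le_sum fun j _ => ?_
  have hK : (m j ^ 2)⁻¹ ≤ ∑ j, (m j ^ 2)⁻¹ :=
    Finset.single_le_sum (f := fun j => (m j ^ 2)⁻¹) (fun i _ => by positivity)
      (Finset.mem_univ j)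
  set K := ∑ j, (m j ^ 2)⁻¹
  have h1 : 1 ≤ K * m j ^ 2 := by
    have := hm j
    rwa [inv_le_iff_one_le_mul₀ (by positivity)] at hK
  have hK0 : 0 ≤ K := by positivity
  have hS : 0 ≤ ∑ k, pd (component u j) (eX k) (t, x) ^ 2 := by positivity
  nlinarith [mul_nonneg hK0 hS, mul_nonneg hK0 (sq_nonneg (pd (component u j) (eT d) (t, x))),
    mul_nonneg (sub_nonneg.2 h1) (sq_nonneg (component u j (t, x))),
    mul_nonneg (sq_nonneg (m j)) (sq_nonneg (component u j (t, x)))]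

lemma exists_energyDensity_le
    (hu : ContDiffOn ℝ 2 (fun p : ℝ × Vec d => u p.1 p.2) (Ici T ×ˢ univ)) (m : Fin N → ℝ) :
    ∃ M > 0, ∀ t, T < t → ∀ x, energyDensity m (component u) (t, x) ≤ M * jetSq T u t x := by
  refine ⟨1 + ∑ j, m j ^ 2, by positivity, fun t ht x => ?_⟩
  rw [jetSq_eq_sum hu ht, energyDensity, Finset.mul_sum]
  refine Finset.sum_le_sum fun j _ => ?_
  have hK : m j ^ 2 ≤ ∑ j, m j ^ 2 :=
    Finset.single_le_sum (f := fun j => m j ^ 2) (fun i _ => by positivity) (Finset.mem_univ j)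
  set K := ∑ j, m j ^ 2
  have hK0 : 0 ≤ K := by positivity
  have hS : 0 ≤ ∑ k, pd (component u j) (eX k) (t, x) ^ 2 := by positivity
  nlinarith [mul_nonneg hK0 hS, mul_nonneg hK0 (sq_nonneg (pd (component u j) (eT d) (t, x))),
    mul_nonneg (sub_nonneg.2 hK) (sq_nonneg (component u j (t, x))),
    sq_nonneg (component u j (t, x))]

end Components

/-! ### The decay rate and a Gronwall argument -/

section Scalar

lemma rate_nonneg (d : ℕ) {t : ℝ} (ht : 1 < t) : 0 ≤ rate d t :=
  mul_nonneg (Real.rpow_nonneg (by linarith) _) (Real.rpow_nonneg (Real.log_nonneg ht.le) _)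

lemma rate_sq (d : ℕ) {t : ℝ} (ht : 1 < t) : rate d t ^ 2 = (t * Real.log t)⁻¹ ^ d := by
  have h0 : 0 < t := by linarith
  have hl := Real.log_pos ht
  rw [rate, ← Real.mul_rpow h0.le hl.le, ← Real.rpow_natCast, ← Real.rpow_mul (by positivity),
    ← Real.rpow_natCast, Real.inv_rpow (by positivity), ← Real.rpow_neg (by positivity)]
  congr 1
  push_cast
  ring

/-- A factor `a ≤ S` in front of the critical power `S ^ (1 + 2 / d)` gains through
`a ≤ a ^ (1 / d) * S ^ (1 - 1 / d)`, which leaves `(a * S) ^ (1 / d) * S ^ 2`. -/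
lemma mul_rpow_critical_le {d : ℕ} (hd : 0 < d) {a S τ : ℝ} (ha : 0 ≤ a) (haS : a ≤ S)
    (hτ : 0 ≤ τ) (h : a * S ≤ τ ^ d) :
    a * (S ^ 2) ^ ((1 / 2 : ℝ) * (1 + 2 / (d : ℝ))) ≤ τ * S ^ 2 := by
  rcases ha.eq_or_lt with rfl | ha'
  · rw [zero_mul]; positivity
  have hS : 0 < S := ha'.trans_le haS
  have hd' : (1 : ℝ) ≤ d := by exact_mod_cast hd
  have hd0 : (0 : ℝ) < d := by linarith
  have hq : 0 ≤ 1 - 1 / (d : ℝ) := by rw [sub_nonneg, div_le_one hd0]; exact hd'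
  have h1 : (S ^ 2) ^ ((1 / 2 : ℝ) * (1 + 2 / (d : ℝ))) = S ^ (1 + 2 / (d : ℝ)) := by
    rw [← Real.rpow_natCast, ← Real.rpow_mul hS.le]
    congr 1
    push_cast
    ring
  have h2 : a ≤ a ^ (1 / (d : ℝ)) * S ^ (1 - 1 / (d : ℝ)) := by
    calc a = a ^ (1 / (d : ℝ)) * a ^ (1 - 1 / (d : ℝ)) := by
          rw [← Real.rpow_add ha', add_sub_cancel, Real.rpow_one]
      _ ≤ _ := by gcongr
  have h3 : (a * S) ^ (1 / (d : ℝ)) ≤ τ := by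
    calc (a * S) ^ (1 / (d : ℝ)) ≤ (τ ^ d) ^ (1 / (d : ℝ)) := by gcongr
      _ = τ := by rw [one_div, Real.pow_rpow_inv_natCast hτ hd.ne']
  calc a * (S ^ 2) ^ ((1 / 2 : ℝ) * (1 + 2 / (d : ℝ)))
      ≤ (a ^ (1 / (d : ℝ)) * S ^ (1 - 1 / (d : ℝ))) * S ^ (1 + 2 / (d : ℝ)) := by
        rw [h1]; gcongr
    _ = (a * S) ^ (1 / (d : ℝ)) * S ^ 2 := by
        rw [Real.mul_rpow ha hS.le, mul_assoc, mul_assoc, ← Real.rpow_add hS, ← Real.rpow_natCast S,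
          ← Real.rpow_add hS]
        congr 2
        push_cast
        ring
    _ ≤ τ * S ^ 2 := by gcongr

/-- A Gronwall argument from infinity: a function that decreases at most at the relative rate
`q / (t log t)`, that is, like `(log t) ^ (-q)`, cannot be positive and decay faster. -/
lemma nonpos_of_log_gronwall {E E' : ℝ → ℝ} {a q D : ℝ} (ha : 1 ≤ a) (hq : 0 < q)
    (hE : ∀ t, a < t → HasDerivAt E (E' t) t)
    (hE' : ∀ t, a < t → -(q * (t * Real.log t)⁻¹) * E t ≤ E' t)
    (hD : ∀ᶠ t in atTop, E t ≤ D * Real.log t ^ (-(2 * q))) {t₀ : ℝ} (ht₀ : a < t₀) :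
    E t₀ ≤ 0 := by
  have hlog : ∀ t, a < t → 0 < Real.log t := fun t ht => Real.log_pos (ha.trans_lt ht)
  have hder : ∀ t, a < t → HasDerivAt (fun s => E s * Real.log s ^ q)
      (E' t * Real.log t ^ q + E t * (t⁻¹ * q * Real.log t ^ (q - 1))) t := fun t ht =>
    (hE t ht).mul ((Real.hasDerivAt_log (by linarith)).rpow_const (Or.inl (hlog t ht).ne'))
  have hmono : MonotoneOn (fun s => E s * Real.log s ^ q) (Ioi a) := by
    refine monotoneOn_of_deriv_nonneg (convex_Ioi a)
      (fun t ht => (hder t ht).continuousAt.continuousWithinAt)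
      (fun t ht => (hder t (interior_subset ht)).differentiableAt.differentiableWithinAt)
      fun t ht => ?_
    have ht : a < t := interior_subset ht
    have hl := hlog t ht
    rw [(hder t ht).deriv, Real.rpow_sub_one hl.ne']
    have h := mul_le_mul_of_nonneg_right (hE' t ht) (Real.rpow_nonneg hl.le q)
    have h2 : E t * (t⁻¹ * q * (Real.log t ^ q / Real.log t))
        = q * (t * Real.log t)⁻¹ * E t * Real.log t ^ q := by
      rw [mul_inv]; ring
    rw [h2]
    linarith
  have hlim : Tendsto (fun t => D * Real.log t ^ (-q)) atTop (𝓝 0) := by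
    simpa using ((tendsto_rpow_neg_atTop hq).comp Real.tendsto_log_atTop).const_mul D
  have hle : E t₀ * Real.log t₀ ^ q ≤ 0 := by
    refine ge_of_tendsto hlim ?_
    filter_upwards [hD, eventually_ge_atTop t₀] with t hDt ht
    have hl := hlog t (ht₀.trans_le ht)
    calc E t₀ * Real.log t₀ ^ q ≤ E t * Real.log t ^ q := hmono ht₀ (ht₀.trans_le ht) ht
      _ ≤ D * Real.log t ^ (-(2 * q)) * Real.log t ^ q := by gcongr
      _ = D * Real.log t ^ (-q) := by
          rw [mul_assoc, ← Real.rpow_add hl]; congr 2; ring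
  exact nonpos_of_mul_nonpos_left hle (Real.rpow_pos_of_pos (hlog t₀ ht₀) q)

lemma ae_norm_le_of_supNorm_le {d : ℕ} {E : Type*} [NormedAddCommGroup E] {f : Vec d → E}
    {B : ℝ} (hB : 0 ≤ B) (h : supNorm f ≤ ENNReal.ofReal B) : ∀ᵐ x, ‖f x‖ ≤ B := by
  rw [supNorm, eLpNorm_exponent_top] at h
  filter_upwards [ae_le_eLpNormEssSup (f := f) (μ := volume)] with x hx
  have := hx.trans h
  rwa [← ofReal_norm, ENNReal.ofReal_le_ofReal_iff hB] at this

end Scalar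

/-! ### The decay argument -/

section Decay

variable {N d : ℕ} {T : ℝ} {u : ℝ → Vec d → Vec N} {m : Fin N → ℝ}
  {F : Vec N → Vec N → Matrix (Fin N) (Fin d) ℝ → Vec N}

lemma frob_nonneg (Θ : Matrix (Fin N) (Fin d) ℝ) : 0 ≤ frob Θ := Real.sqrt_nonneg _

/-- Pointwise control of the forcing term of the energy identity by the energy density: `τ` is
the relative rate obtained from the smallness of `|∂ₜ u|` times the size of the whole jet. -/
lemma neg_mul_energyDensity_le (hd : 0 < d) (hu : IsClassicalSolution m F (Ici T) u)
    {C₀ K τ : ℝ} (hC₀ : 0 ≤ C₀) (hτ : 0 ≤ τ) {t : ℝ} (ht : T < t) {x : Vec d}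
    (hF : ∀ ζ η Θ, ‖F ζ η Θ‖ ≤
      C₀ * (‖ζ‖ ^ 2 + ‖η‖ ^ 2 + frob Θ ^ 2) ^ ((1 / 2 : ℝ) * (1 + 2 / (d : ℝ))))
    (hK : jetSq T u t x ≤ K * energyDensity m (component u) (t, x))
    (hsmall : ‖timeDeriv (Ici T) u t x‖ * √(jetSq T u t x) ≤ τ ^ d) :
    -(2 * C₀ * τ * K) * energyDensity m (component u) (t, x) ≤
      ∑ j, 2 * (pd (component u j) (eT d) (t, x) *
        kleinGordonOp (m j) (component u j) (t, x)) := by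
  set η := timeDeriv (Ici T) u t x with hη
  set G := F (u t x) η (spaceDeriv u t x) with hG
  have hJ0 : 0 ≤ jetSq T u t x := by unfold jetSq; positivity
  have hle : ‖η‖ ≤ √(jetSq T u t x) := by
    refine Real.le_sqrt_of_sq_le ?_
    unfold jetSq
    linarith [sq_nonneg ‖u t x‖, sq_nonneg (frob (spaceDeriv u t x))]
  have hcrit := mul_rpow_critical_le hd (norm_nonneg η) hle hτ hsmall
  rw [Real.sq_sqrt hJ0] at hcrit
  have hprod : ‖η‖ * ‖G‖ ≤ C₀ * (τ * (K * energyDensity m (component u) (t, x))) := by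
    calc ‖η‖ * ‖G‖ ≤ ‖η‖ * (C₀ * jetSq T u t x ^ ((1 / 2 : ℝ) * (1 + 2 / (d : ℝ)))) := by
          gcongr; exact hF _ _ _
      _ = C₀ * (‖η‖ * jetSq T u t x ^ ((1 / 2 : ℝ) * (1 + 2 / (d : ℝ)))) := by ring
      _ ≤ C₀ * (τ * jetSq T u t x) := by gcongr
      _ ≤ _ := by gcongr
  have hinner : ∑ j, 2 * (pd (component u j) (eT d) (t, x) *
      kleinGordonOp (m j) (component u j) (t, x)) = 2 * inner ℝ G η := by
    rw [PiLp.inner_apply, Finset.mul_sum]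
    refine Finset.sum_congr rfl fun j _ => ?_
    rw [hu.kleinGordonOp_component ht, ← timeDeriv_apply hu.contDiffOn ht]
    simp [hG, hη]
  rw [hinner]
  have h1 := (abs_le.1 (abs_real_inner_le_norm G η)).1
  linarith [mul_comm ‖η‖ ‖G‖]

/-- On an expanding cone a jet of size `O(rate d t)` has weighted energy `O((log t) ^ (-d))`. -/
lemma integral_energy_le {c A M : ℝ} {x₀ : Vec d} {φ : ℝ × Vec d → ℝ}
    (hφ : IsCausalWeight c x₀ φ)
    (hu : ContDiffOn ℝ 2 (fun p : ℝ × Vec d => u p.1 p.2) (Ici T ×ˢ univ)) (hM : 0 ≤ M)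
    {t : ℝ} (ht : T < t) (ht1 : 1 < t) (hct : |c| ≤ t)
    (hE : ∀ x, energyDensity m (component u) (t, x) ≤ M * jetSq T u t x)
    (hA : ∀ᵐ x, jetSq T u t x ≤ (A * rate d t) ^ 2) :
    ∫ x, φ (t, x) * energyDensity m (component u) (t, x) ≤
      M * A ^ 2 * 2 ^ d * volume.real (ball (0 : Vec d) 1) *
        Real.log t ^ (-(2 * ((d : ℝ) / 2))) := by
  have hl := Real.log_pos ht1
  have ht0 : 0 < t := by linarith
  have hc := abs_le.1 hct
  set B := closedBall x₀ (t + c)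
  have hint : Integrable fun x => φ (t, x) * energyDensity m (component u) (t, x) :=
    integrable_slice (f := fun p => φ p * energyDensity m (component u) p)
      (hφ.contDiff.continuous.continuousOn.mul
        (contDiffOn_energyDensity m (contDiffOn_component hu)).continuousOn)
      (hφ.supported.mul_right _) ht
  have hbound : ∀ᵐ x, φ (t, x) * energyDensity m (component u) (t, x) ≤
      B.indicator (fun _ => M * (A * rate d t) ^ 2) x := by
    filter_upwards [hA] with x hx
    by_cases hxB : x ∈ B
    · rw [indicator_of_mem hxB]
      calc φ (t, x) * energyDensity m (component u) (t, x)
          ≤ 1 * energyDensity m (component u) (t, x) :=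
            mul_le_mul_of_nonneg_right (hφ.le_one _) (energyDensity_nonneg _ _ _)
        _ ≤ M * jetSq T u t x := by rw [one_mul]; exact hE x
        _ ≤ _ := by gcongr
    · rw [indicator_of_notMem hxB, hφ.supported t x (by simpa [B] using hxB), zero_mul]
  have hBi : Integrable (B.indicator fun _ => M * (A * rate d t) ^ 2) :=
    (integrable_indicator_iff measurableSet_closedBall).2
      (integrableOn_const measure_closedBall_lt_top.ne)
  calc ∫ x, φ (t, x) * energyDensity m (component u) (t, x)
      ≤ ∫ x, B.indicator (fun _ => M * (A * rate d t) ^ 2) x := integral_mono_ae hint hBi hbound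
    _ = (t + c) ^ d * volume.real (ball (0 : Vec d) 1) * (M * (A * rate d t) ^ 2) := by
        rw [integral_indicator measurableSet_closedBall, setIntegral_const,
          Measure.addHaar_real_closedBall _ _ (by linarith), finrank_euclideanSpace_fin,
          smul_eq_mul]
    _ ≤ (2 * t) ^ d * volume.real (ball (0 : Vec d) 1) * (M * (A * rate d t) ^ 2) := by
        gcongr <;> linarith
    _ = _ := by
        rw [mul_pow A, rate_sq d ht1, mul_div_cancel₀ _ (two_ne_zero' ℝ), Real.rpow_neg hl.le,
          Real.rpow_natCast, inv_pow, mul_pow t, mul_pow 2 t]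
        field_simp

/-- A solution with the stated decay vanishes after the time from which the smallness of
`∂ₜ u` holds, if that smallness beats the constants of the energy estimate. -/
lemma eq_zero_of_decay (hd : 0 < d) (hu : IsClassicalSolution m F (Ici T) u) {C₀ A K τ T₂ : ℝ}
    (hC₀ : 0 ≤ C₀)
    (hF : ∀ ζ η Θ, ‖F ζ η Θ‖ ≤
      C₀ * (‖ζ‖ ^ 2 + ‖η‖ ^ 2 + frob Θ ^ 2) ^ ((1 / 2 : ℝ) * (1 + 2 / (d : ℝ))))
    (hK : ∀ t, T < t → ∀ x, jetSq T u t x ≤ K * energyDensity m (component u) (t, x))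
    (hT₂ : 1 < T₂) (hTT₂ : T ≤ T₂) (hτ : 0 ≤ τ) (hsmall : 2 * C₀ * τ * K ≤ (d : ℝ) / 2)
    (hjet : ∀ t, T₂ < t → ∀ᵐ x, √(jetSq T u t x) ≤ A * rate d t)
    (hprod : ∀ t, T₂ < t → ∀ᵐ x, ‖timeDeriv (Ici T) u t x‖ * √(jetSq T u t x) ≤
      (τ * (t * Real.log t)⁻¹) ^ d) {t₀ : ℝ} (ht₀ : T₂ < t₀) (x₀ : Vec d) :
    u t₀ x₀ = 0 := by
  obtain ⟨M, hM, hEM⟩ := exists_energyDensity_le hu.contDiffOn m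
  have hw := contDiffOn_component hu.contDiffOn
  have hE := contDiffOn_energyDensity m hw
  -- This shift makes the weight equal to `1` at `(t₀, x₀)`.
  set c := 2 - t₀
  set φ := coneWeight c x₀
  have hφ : IsCausalWeight c x₀ φ := isCausalWeight_coneWeight c x₀
  have hsupp : SupportedInCone c x₀ fun p => φ p * energyDensity m (component u) p :=
    hφ.supported.mul_right _
  have hφE : ContDiffOn ℝ 1 (fun p => φ p * energyDensity m (component u) p) (future d T) :=
    hφ.contDiff.contDiffOn.mul hE
  have hle : ∫ x, φ (t₀, x) * energyDensity m (component u) (t₀, x) ≤ 0 := by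
    refine nonpos_of_log_gronwall (a := T₂) (q := (d : ℝ) / 2)
      (E := fun t => ∫ x, φ (t, x) * energyDensity m (component u) (t, x)) hT₂.le (by positivity)
      (fun t ht => hasDerivAt_integral_slice hφE hsupp (hTT₂.trans_lt ht)) (fun t ht => ?_)
      (D := M * A ^ 2 * 2 ^ d * volume.real (ball (0 : Vec d) 1)) ?_ ht₀
    · have hl : 0 < (t * Real.log t)⁻¹ := by
        have := Real.log_pos (hT₂.trans ht)
        have : 0 < t := by linarith
        positivity
      refine hφ.neg_mul_energy_le hw (hTT₂.trans_lt ht) ?_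
      filter_upwards [hprod t ht] with x hx
      refine le_trans ?_ (neg_mul_energyDensity_le hd hu hC₀ (mul_nonneg hτ hl.le)
        (hTT₂.trans_lt ht) hF (hK t (hTT₂.trans_lt ht) x) hx)
      refine mul_le_mul_of_nonneg_right (neg_le_neg ?_) (energyDensity_nonneg _ _ _)
      calc 2 * C₀ * (τ * (t * Real.log t)⁻¹) * K
          = 2 * C₀ * τ * K * (t * Real.log t)⁻¹ := by ring
        _ ≤ _ := by gcongr
    · filter_upwards [eventually_gt_atTop T₂, eventually_ge_atTop |c|] with t ht hct
      refine integral_energy_le hφ hu.contDiffOn hM.le (hTT₂.trans_lt ht) (hT₂.trans ht) hct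
        (hEM t (hTT₂.trans_lt ht)) ?_
      filter_upwards [hjet t ht] with x hx
      exact (Real.sqrt_le_left (le_trans (Real.sqrt_nonneg _) hx)).1 hx
  have hT₀ : T < t₀ := hTT₂.trans_lt ht₀
  have hzero : φ (t₀, x₀) * energyDensity m (component u) (t₀, x₀) = 0 := by
    by_contra hne
    exact absurd hle (not_le.2 (Continuous.integral_pos_of_hasCompactSupport_nonneg_nonzero
      (contDiff_slice hφE hT₀).continuous (hsupp.hasCompactSupport_slice t₀)
      (fun x => mul_nonneg (hφ.nonneg _) (energyDensity_nonneg _ _ _)) hne))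
  have hφ1 : φ (t₀, x₀) = 1 := by
    simp only [φ, c, coneWeight, sub_self, norm_zero]
    exact Real.smoothTransition.one_of_one_le (by norm_num)
  rw [hφ1, one_mul] at hzero
  have hjet0 := hK t₀ hT₀ x₀
  rw [hzero, mul_zero, jetSq] at hjet0
  have : ‖u t₀ x₀‖ ^ 2 ≤ 0 := by
    linarith [sq_nonneg ‖timeDeriv (Ici T) u t₀ x₀‖, sq_nonneg (frob (spaceDeriv u t₀ x₀))]
  exact norm_eq_zero.1 (pow_eq_zero_iff two_ne_zero |>.1 (this.antisymm (sq_nonneg _)))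

lemma isClassicalSolution_zero (hd : 0 < d) (hF : CriticalGrowth F) (I : Set ℝ) :
    IsClassicalSolution m F I (fun _ _ => 0 : ℝ → Vec d → Vec N) := by
  obtain ⟨C₀, hC₀⟩ := hF
  have hF0 : F 0 0 0 = 0 := by
    have h := hC₀ 0 0 0
    have hd' : (0 : ℝ) < d := by exact_mod_cast hd
    have h0 : (0 : ℝ) ^ ((1 / 2 : ℝ) * (1 + 2 / (d : ℝ))) = 0 :=
      Real.zero_rpow (by positivity)
    simpa [frob, -one_div, h0] using h
  refine ⟨contDiffOn_const, fun t _ x j => ?_⟩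
  have h1 : timeDeriv I (fun _ _ => 0 : ℝ → Vec d → Vec N) t x = 0 := by simp [timeDeriv]
  have h2 : spaceDeriv (fun _ _ => 0 : ℝ → Vec d → Vec N) t x = 0 := by
    ext j k; simp [spaceDeriv]
  have h3 : Laplacian.laplacian (fun _ : Vec d => (0 : ℝ)) x = 0 := by
    rw [InnerProductSpace.laplacian_eq_iteratedFDeriv_stdOrthonormalBasis]
    simp
  have h4 : iteratedDerivWithin 2 (fun _ : ℝ => (0 : ℝ)) I t = 0 := by
    simp
  rw [h1, h2, hF0]
  simp [h3, h4]

end Decay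

end KleinGordon

end

open KleinGordon MeasureTheory Filter Topology in
theorem theorem1 {N d : ℕ} (hd : 0 < d) (m : Fin N → ℝ) (hm : ∀ j, 0 < m j)
    (F : KleinGordon.Vec N → KleinGordon.Vec N → Matrix (Fin N) (Fin d) ℝ → KleinGordon.Vec N)
    (hF : KleinGordon.CriticalGrowth F)
    (huniq : KleinGordon.UniqueClassicalSolutions m F)
    (T : ℝ) (u : ℝ → KleinGordon.Vec d → KleinGordon.Vec N)
    (hu : KleinGordon.IsClassicalSolution m F (Set.Ici T) u)
    (C T₁ : ℝ) (hC : 0 < C) (hT₁ : 1 < T₁) (hTT₁ : T ≤ T₁)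
    (hdecay : ∀ t : ℝ, T₁ ≤ t →
      KleinGordon.supNorm (u t)
          + KleinGordon.supNorm (fun x => KleinGordon.frob (KleinGordon.spaceDeriv u t x))
        ≤ ENNReal.ofReal (C * KleinGordon.rate d t))
    (hdecay_t : ∀ ε : ℝ, 0 < ε → ∃ T₂ : ℝ, T₁ ≤ T₂ ∧ ∀ t : ℝ, T₂ ≤ t →
      KleinGordon.supNorm (KleinGordon.timeDeriv (Set.Ici T) u t)
        ≤ ENNReal.ofReal (ε * KleinGordon.rate d t)) :
    ∀ t : ℝ, T ≤ t → ∀ x : KleinGordon.Vec d, u t x = 0 := by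
  obtain ⟨C₀, hC₀⟩ := id hF
  obtain ⟨K, hK, hjetK⟩ := exists_jetSq_le hu.contDiffOn hm
  have hd' : (0 : ℝ) < d := by exact_mod_cast hd
  have hF' : ∀ ζ η Θ, ‖F ζ η Θ‖ ≤
      |C₀| * (‖ζ‖ ^ 2 + ‖η‖ ^ 2 + frob Θ ^ 2) ^ ((1 / 2 : ℝ) * (1 + 2 / (d : ℝ))) :=
    fun ζ η Θ => (hC₀ ζ η Θ).trans (by gcongr; exact le_abs_self _)
  -- With `|∂ₜ u| ≤ ε * rate` and a jet of size at most `A * rate`, the relative rate of decrease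
  -- of the energy is at most `2 * |C₀| * τ * K / (t log t)`, as `ε * A ≤ τ ^ d`.
  set A := 2 * C + 1 with hA
  set τ := (d : ℝ) / (4 * (|C₀| + 1) * K) with hτ
  have hA0 : 0 < A := by positivity
  have hτ0 : 0 < τ := by positivity
  have hsmall : 2 * |C₀| * τ * K ≤ (d : ℝ) / 2 := by
    have h : 2 * |C₀| * τ * K = (|C₀| / (|C₀| + 1)) * ((d : ℝ) / 2) := by
      rw [hτ]; field_simp; ring
    rw [h]
    refine mul_le_of_le_one_left (by positivity) ((div_le_one (by positivity)).2 ?_)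
    linarith
  set ε := min 1 (τ ^ d / A) with hε
  have hε0 : 0 < ε := by positivity
  obtain ⟨T₂, hT₁₂, hT₂⟩ := hdecay_t ε hε0
  have hbounds : ∀ t, T₂ < t → ∀ᵐ x, ‖timeDeriv (Set.Ici T) u t x‖ ≤ ε * rate d t ∧
      √(jetSq T u t x) ≤ A * rate d t := by
    intro t ht
    have hr := rate_nonneg d (hT₁.trans_le hT₁₂ |>.trans ht)
    have h := hdecay t (hT₁₂.trans ht.le)
    filter_upwards [ae_norm_le_of_supNorm_le (by positivity) (le_self_add.trans h),
      ae_norm_le_of_supNorm_le (by positivity) (le_add_self.trans h),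
      ae_norm_le_of_supNorm_le (by positivity) (hT₂ t ht.le)] with x hx1 hx2 hx3
    refine ⟨hx3, Real.sqrt_le_iff.2 ⟨by positivity, ?_⟩⟩
    rw [Real.norm_of_nonneg (frob_nonneg _)] at hx2
    have hx3' : ‖timeDeriv (Set.Ici T) u t x‖ ≤ rate d t :=
      hx3.trans (mul_le_of_le_one_left hr (min_le_left _ _))
    have hsum : ‖u t x‖ + ‖timeDeriv (Set.Ici T) u t x‖ + frob (spaceDeriv u t x) ≤
        A * rate d t := by
      rw [hA]; linarith
    refine le_trans ?_ (pow_le_pow_left₀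
      (add_nonneg (add_nonneg (norm_nonneg _) (norm_nonneg _)) (frob_nonneg _)) hsum 2)
    have h0 := frob_nonneg (spaceDeriv u t x)
    have p1 : 0 ≤ ‖u t x‖ * ‖timeDeriv (Set.Ici T) u t x‖ := by positivity
    have p2 : 0 ≤ ‖u t x‖ * frob (spaceDeriv u t x) := by positivity
    have p3 : 0 ≤ ‖timeDeriv (Set.Ici T) u t x‖ * frob (spaceDeriv u t x) := by positivity
    unfold jetSq
    linarith [add_sq (‖u t x‖ + ‖timeDeriv (Set.Ici T) u t x‖) (frob (spaceDeriv u t x)),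
      add_sq ‖u t x‖ ‖timeDeriv (Set.Ici T) u t x‖]
  have hlate : ∀ t, T₂ < t → ∀ x, u t x = 0 := by
    intro t ht x
    refine eq_zero_of_decay hd hu (abs_nonneg C₀) hF' hjetK (hT₁.trans_le hT₁₂)
      (hTT₁.trans hT₁₂) hτ0.le hsmall (fun s hs => (hbounds s hs).mono fun _ h => h.2)
      (fun s hs => ?_) ht x
    have hs1 : 1 < s := hT₁.trans_le hT₁₂ |>.trans hs
    have hr := rate_nonneg d hs1
    filter_upwards [hbounds s hs] with y hy
    calc ‖timeDeriv (Set.Ici T) u s y‖ * √(jetSq T u s y)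
        ≤ (ε * rate d s) * (A * rate d s) := by gcongr; exacts [hy.1, hy.2]
      _ = (ε * A) * rate d s ^ 2 := by ring
      _ ≤ τ ^ d * rate d s ^ 2 := by
          gcongr
          exact (le_div_iff₀ hA0).1 (min_le_right _ _)
      _ = (τ * (s * Real.log s)⁻¹) ^ d := by rw [rate_sq d hs1, mul_pow]
  have hTT₂ : T ≤ T₂ := hTT₁.trans hT₁₂
  have hderiv : timeDeriv (Set.Ici T) u (T₂ + 1) = 0 := by
    funext x
    have he : (fun s => u s x) =ᶠ[𝓝 (T₂ + 1)] fun _ => 0 := by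
      filter_upwards [lt_mem_nhds (lt_add_one T₂)] with s hs using hlate s hs x
    rw [timeDeriv, derivWithin_of_mem_nhds (Ici_mem_nhds (by linarith)), he.deriv_eq]
    simp
  intro t ht x
  refine huniq (Set.Ici T) Set.ordConnected_Ici
    ⟨T, Set.self_mem_Ici, T + 1, Set.mem_Ici.2 (by linarith), by linarith⟩
    u (fun _ _ => 0) hu (isClassicalSolution_zero hd hF _) (T₂ + 1)
    (Set.mem_Ici.2 (by linarith)) (fun y => hlate _ (lt_add_one T₂) y) (fun y => ?_) t ht x
  rw [hderiv]
  simp [timeDeriv]
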